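/- Definitions. An ordered differential field is an ordered field $K$ with a derivation $\partial\colon K\to K$, $a'=\partial(a)$; put $a^\dagger=a'/a$ for $a\neq0$ and $S^\dagger=\{a^\dagger: a\in S\}$ for $S\subseteq K\setminus\{0\}$. An $H$-field is an ordered differential field $L$ with constant field $C=\{c\in L: c'=0\}$ such that $a'>0$ whenever $a\in L$ and $a>C$, and $\mathcal O=C+\mathfrak{o}$, where $\mathcal O$ is the convex hull of $C$ in $L$ (a valuation ring of $L$) and $\mathfrak{o}$ is the maximal ideal of $\mathcal O$; it is regarded as a valued field with valuation ring $\mathcal O$. A pre-$H$-field is an ordered valued differential subfield $K$ of an $H$-field $L$, that is, a differential subfield with the induced ordering and the valuation ring $\mathcal O\cap K$. Its (surjective) valuation is written $v\colon K^\times\to\Gamma$ with $\Gamma$ an additively written ordered abelian group, the value group of $K$. For $0\neq\gamma\in\Gamma$ one defines (unambiguously) $\psi(\gamma)=v(a^\dagger)\in\Gamma$, where $a\in K^\times$ is any element with $v(a)=\gamma$, and $\Psi=\{\psi(\gamma):0\neq\gamma\in\Gamma\}$. For $r\in\mathbb N$, $K$ has $r$-IVP if for all differential polynomials $P\in K[Y,Y',\dots,Y^{(r)}]$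 and all $f<g$ in $K$ with $P(f)<0<P(g)$ there is $\phi\in K$ with $f<\phi<g$ and $P(\phi)=0$. Put $K^{>}=\{a\in K:a>0\}$ and $K^{<}=\{a\in K:a<0\}$. Statement. Let $K$ be a pre-$H$-field with value group $\Gamma\neq\{0\}$ and with $1$-IVP. Then $\partial K=K$; $(K^{>})^\dagger=(K^{<})^\dagger$, and this set is a convex subgroup of the ordered additive group of $K$; $\Psi$ has no largest element; and $\Psi$ is convex in $\Gamma$. -/

import Mathlib

open scoped Differential

universe u v w

namespace HFieldIVP

section OrderedDifferentialField

variable (K : Type u) [Field K] [LinearOrder K] [IsStrictOrderedRing K] [Differential K]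

/-- The field of constants `C = {c : c′ = 0}` of a differential field. -/
def constants (K : Type u) [Field K] [Differential K] : Subfield K where
  carrier := {c | (c′) = 0}
  zero_mem' := by simp
  one_mem' := by simp
  add_mem' := by
    intro a b ha hb
    simp only [Set.mem_ofPred_eq] at *
    simp [ha, hb]
  mul_mem' := by
    intro a b ha hb
    simp only [Set.mem_ofPred_eq] at *
    simp [ha, hb]
  neg_mem' := by
    intro a ha
    simp only [Set.mem_ofPred_eq] at *
    simp [ha]
  inv_mem' := by
    intro a ha
    simp only [Set.mem_ofPred_eq] at *
    simp [Derivation.leibniz_inv, ha]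

theorem exists_abs_le_of_between {K : Type u} [Field K] [LinearOrder K] [IsStrictOrderedRing K]
    [Differential K] {a : K} (h : ∃ c ∈ constants K, ∃ d ∈ constants K, c ≤ a ∧ a ≤ d) :
    ∃ c ∈ constants K, |a| ≤ c := by
  obtain ⟨c, hc, d, hd, h1, h2⟩ := h
  rcases le_total (-c) d with h | h
  · exact ⟨d, hd, abs_le.2 ⟨by linarith, h2⟩⟩
  · exact ⟨-c, neg_mem hc, abs_le.2 ⟨by linarith, by linarith⟩⟩

theorem between_of_exists_abs_le {K : Type u} [Field K] [LinearOrder K] [IsStrictOrderedRing K]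
    [Differential K] {a : K} (h : ∃ c ∈ constants K, |a| ≤ c) :
    ∃ c ∈ constants K, ∃ d ∈ constants K, c ≤ a ∧ a ≤ d := by
  obtain ⟨c, hc, h⟩ := h
  exact ⟨-c, neg_mem hc, c, hc, (abs_le.1 h).1, (abs_le.1 h).2⟩

/-- The convex hull `𝒪` of the constant field `C` in the ordered field `K`; it is a valuation
ring of `K`. -/
def convexHullConstants : ValuationSubring K where
  carrier := {a | ∃ c ∈ constants K, ∃ d ∈ constants K, c ≤ a ∧ a ≤ d}
  zero_mem' := ⟨0, zero_mem _, 0, zero_mem _, le_rfl, le_rfl⟩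
  one_mem' := ⟨1, one_mem _, 1, one_mem _, le_rfl, le_rfl⟩
  add_mem' := by
    rintro a b ⟨c, hc, d, hd, h1, h2⟩ ⟨c', hc', d', hd', h1', h2'⟩
    exact ⟨c + c', add_mem hc hc', d + d', add_mem hd hd', add_le_add h1 h1', add_le_add h2 h2'⟩
  mul_mem' := by
    intro a b ha hb
    obtain ⟨c, hc, h1⟩ := exists_abs_le_of_between ha
    obtain ⟨d, hd, h2⟩ := exists_abs_le_of_between hb
    refine between_of_exists_abs_le ⟨c * d, mul_mem hc hd, ?_⟩
    rw [abs_mul]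
    exact mul_le_mul h1 h2 (abs_nonneg _) ((abs_nonneg _).trans h1)
  neg_mem' := by
    rintro a ⟨c, hc, d, hd, h1, h2⟩
    exact ⟨-d, neg_mem hd, -c, neg_mem hc, neg_le_neg h2, neg_le_neg h1⟩
  mem_or_inv_mem' := by
    intro a
    rcases le_total |a| 1 with h | h
    · exact Or.inl (between_of_exists_abs_le ⟨1, one_mem _, h⟩)
    · refine Or.inr (between_of_exists_abs_le ⟨1, one_mem _, ?_⟩)
      rw [abs_inv]
      exact inv_le_one_of_one_le₀ h

/-- An `H`-field: an ordered differential field `K` with constant field `C` such that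
* `a′ > 0` whenever `a > C`;
* `𝒪 = C + 𝔬`, where `𝒪` is the convex hull of `C` in `K` and `𝔬` is the maximal ideal of `𝒪`
  (as a subset of `K`, this is the set of nonunits of the valuation ring `𝒪`). -/
structure IsHField : Prop where
  deriv_pos : ∀ a : K, (∀ c ∈ constants K, c < a) → 0 < (a′)
  mem_hull_iff : ∀ a : K, a ∈ convexHullConstants K ↔
    ∃ c ∈ constants K, ∃ e ∈ (convexHullConstants K).nonunits, a = c + e

/-- In an `H`-field, if `b > C` and `e` is infinitesimal relative to `C`, then `|e′| ≤ c · b†` for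
every constant `c > 0`. -/
theorem IsHField.abs_deriv_le {L : Type w} [Field L] [LinearOrder L] [IsStrictOrderedRing L]
    [Differential L] (hL : IsHField L) {b e c : L} (hb : ∀ d ∈ constants L, d < b)
    (he : ∀ d ∈ constants L, 0 < d → |e| ≤ d) (hc : c ∈ constants L) (hc0 : 0 < c) :
    |e′| ≤ c * Differential.logDeriv b := by
  have hb0 : 0 < b := hb 0 (zero_mem _)
  have hc2 : c / 2 ∈ constants L := div_mem hc (ofNat_mem _ 2)
  have hc2' : (c / 2)′ = 0 := hc2
  have hc20 : 0 < c / 2 := by linarith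
  have hc4 : c / 4 ∈ constants L := div_mem hc (ofNat_mem _ 4)
  have hb' := hL.deriv_pos b hb
  have key : ∀ t : L, |t| ≤ c / 4 → - t′ * b ≤ c * b′ := by
    intro t ht
    obtain ⟨h1, h2⟩ := abs_le.1 ht
    have hgt : ∀ d ∈ constants L, d < b * (c / 2 + t) := by
      intro d hd
      have h3 := hb (d / (c / 4)) (div_mem hd hc4)
      rw [div_lt_iff₀ (by linarith)] at h3
      have : b * (c / 4) ≤ b * (c / 2 + t) := mul_le_mul_of_nonneg_left (by linarith) hb0.le
      linarith
    have h4 := hL.deriv_pos _ hgt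
    rw [Derivation.leibniz, map_add, hc2', smul_eq_mul, smul_eq_mul] at h4
    nlinarith
  have h4 := he _ hc4 (by linarith)
  have k1 := key e h4
  have k2 := key (-e) (by rwa [abs_neg])
  rw [map_neg] at k2
  have : c * Differential.logDeriv b = c * b′ / b := by
    rw [Differential.logDeriv, mul_div_assoc]
  rw [this, le_div_iff₀ hb0]
  rcases abs_cases (e′) with ⟨h, _⟩ | ⟨h, _⟩ <;> rw [h] <;> linarith

theorem not_mem_hull_iff_of_pos {L : Type w} [Field L] [LinearOrder L] [IsStrictOrderedRing L]
    [Differential L] {b : L} (hb0 : 0 < b) :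
    b ∉ convexHullConstants L ↔ ∀ d ∈ constants L, d < b := by
  constructor
  · intro h d hd
    by_contra hlt
    exact h ⟨0, zero_mem _, d, hd, hb0.le, not_lt.1 hlt⟩
  · rintro h ⟨c, hc, d, hd, h1, h2⟩
    exact absurd (h d hd) (not_lt.2 h2)

theorem abs_le_of_mem_nonunits {L : Type w} [Field L] [LinearOrder L] [IsStrictOrderedRing L]
    [Differential L] {e d : L} (he : e ∈ (convexHullConstants L).nonunits)
    (hd : d ∈ constants L) (hd0 : 0 < d) : |e| ≤ d := by
  by_contra hlt
  rw [not_le] at hlt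
  rcases (ValuationSubring.mem_nonunits_iff_or _).1 he with h | h
  · simp [h] at hlt; linarith
  · refine h (between_of_exists_abs_le ⟨d⁻¹, inv_mem hd, ?_⟩)
    rw [abs_inv]
    exact inv_anti₀ hd0 hlt.le


variable {K}

/-- The value `P(y)` of a differential polynomial `P ∈ K{Y}` at `y`. Here
`K{Y} = K[Y, Y′, Y″, …]` is the ring of polynomials over `K` in the variables `Y⁽ⁿ⁾`, `n : ℕ`,
and `P(y)` is obtained by substituting the `n`-th derivative of `y` for `Y⁽ⁿ⁾`. -/
noncomputable def evalDiffPoly {K : Type u} [Field K] [Differential K]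
    (P : MvPolynomial ℕ K) (y : K) : K :=
  MvPolynomial.eval (fun n : ℕ => (fun z : K => z′)^[n] y) P

variable (K)

/-- The intermediate value property for differential polynomials of order at most `r`, that is,
for those `P` that lie in `K[Y, Y′, …, Y⁽ʳ⁾]`. -/
def HasIVP (r : ℕ) : Prop :=
  ∀ P ∈ MvPolynomial.supported K {n : ℕ | n ≤ r}, ∀ f g : K, f < g →
    evalDiffPoly P f < 0 → 0 < evalDiffPoly P g →
      ∃ φ : K, f < φ ∧ φ < g ∧ evalDiffPoly P φ = 0

end OrderedDifferentialField

section Valued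

variable {K : Type u} [Field K] [LinearOrder K] [IsStrictOrderedRing K] [Differential K]
  {Γ : Type v} [AddCommGroup Γ] [LinearOrder Γ] [IsOrderedAddMonoid Γ]

/-- The ordered differential field `K` with the (additively written) valuation `val` is a
pre-`H`-field: it is isomorphic to an ordered valued differential subfield of an `H`-field `L`.
The valuation ring of `L` is the convex hull of its constant field; the embedding `ι` respects the
ordering, the derivation and the valuation rings. -/
def IsPreHField (val : AddValuation K (WithTop Γ)) : Prop :=
  ∃ (L : Type w) (_ : Field L) (_ : LinearOrder L) (_ : IsStrictOrderedRing L)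
    (_ : Differential L) (ι : K →+* L),
    IsHField L ∧ StrictMono ι ∧ (∀ a : K, ι (a′) = (ι a)′) ∧
      ∀ a : K, 0 ≤ val a ↔ ι a ∈ convexHullConstants L

/-- The graph of the map `ψ : Γ \ {0} → Γ` of the asymptotic couple `(Γ, ψ)`, given by
`ψ(v a) = v(a†)` for `a ∈ K` with `a ≠ 0` and `v a ≠ 0`, where `a† = a′ / a`. -/
def IsPsi (val : AddValuation K (WithTop Γ)) (γ δ : Γ) : Prop :=
  γ ≠ 0 ∧ ∃ a : K, val a = (γ : WithTop Γ) ∧ val (Differential.logDeriv a) = (δ : WithTop Γ)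

/-- In a pre-`H`-field, `b† ≻ u†` whenever `u ≍ 1` and `b ≻ 1`. -/
theorem IsPreHField.val_logDeriv_lt {val : AddValuation K (WithTop Γ)}
    (hK : IsPreHField.{u, v, w} val) {u b : K} (hu : val u = 0) (hb : val b < 0) :
    val (Differential.logDeriv b) < val (Differential.logDeriv u) := by
  wlog hb0 : 0 < b generalizing b
  · have hb1 : b ≠ 0 := by rintro rfl; simp at hb
    have := this (b := -b) (by rwa [AddValuation.map_neg])
      (neg_pos.2 (lt_of_le_of_ne (not_lt.1 hb0) hb1))
    rwa [show Differential.logDeriv (-b) = Differential.logDeriv b by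
      simp [Differential.logDeriv]] at this
  obtain ⟨L, _, _, _, _, ι, hL, hι, hd, hv⟩ := hK
  have hιb0 : 0 < ι b := by simpa using hι hb0
  have hιb : ∀ d ∈ constants L, d < ι b :=
    (not_mem_hull_iff_of_pos hιb0).1 fun h => absurd ((hv b).2 h) (not_le.2 hb)
  obtain ⟨c, hc, e, he, hce⟩ := (hL.mem_hull_iff _).1 ((hv u).1 hu.ge)
  have hu' : ι (u′) = (e′) := by
    rw [hd, hce, map_add, show (c′) = 0 from hc, zero_add]
  have hlog : ι (Differential.logDeriv b) = Differential.logDeriv (ι b) := by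
    simp [Differential.logDeriv, hd]
  have hbpos : 0 < Differential.logDeriv (ι b) := div_pos (hL.deriv_pos _ hιb) hιb0
  have hb' : Differential.logDeriv b ≠ 0 := by
    intro h
    rw [← hlog, h, map_zero] at hbpos
    exact lt_irrefl _ hbpos
  have hlt : val (Differential.logDeriv b) < val (u′) := by
    by_contra hle
    rw [not_lt] at hle
    have hu0 : (u′) ≠ 0 := by
      intro h
      rw [h, AddValuation.map_zero, top_le_iff, AddValuation.top_iff] at hle
      exact hb' hle
    have h0 : 0 ≤ val (Differential.logDeriv b / (u′)) := by
      by_contra hneg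
      rw [not_le] at hneg
      have h1 : val (Differential.logDeriv b) = val (Differential.logDeriv b / (u′)) + val (u′) := by
        rw [← AddValuation.map_mul, div_mul_cancel₀ _ hu0]
      have h2 : val (u′) ≠ ⊤ := by rwa [Ne, AddValuation.top_iff]
      have h3 := (WithTop.add_lt_add_iff_right h2).2 hneg
      rw [← h1, zero_add] at h3
      exact absurd h3 (not_lt.2 hle)
    obtain ⟨k, hk, hk1⟩ := exists_abs_le_of_between ((hv _).1 h0)
    have hk0 : 0 ≤ k := (abs_nonneg _).trans hk1
    have hk' : (k + 1)⁻¹ ∈ constants L := inv_mem (add_mem hk (one_mem _))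
    have h3 := hL.abs_deriv_le hιb (fun d hd hd0 => abs_le_of_mem_nonunits he hd hd0) hk'
      (by positivity)
    rw [map_div₀, hlog, hu', abs_div, abs_of_pos hbpos] at hk1
    have he0 : 0 < |(e′)| := by
      rw [abs_pos, ← hu']
      simpa using hu0
    rw [div_le_iff₀ he0] at hk1
    rw [inv_mul_eq_div, le_div_iff₀ (by positivity)] at h3
    linarith
  have : val (u′) = val (Differential.logDeriv u) + val u := by
    have hu0 : u ≠ 0 := by rintro rfl; simp at hu
    rw [← AddValuation.map_mul, Differential.logDeriv, div_mul_cancel₀ _ hu0]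
  rwa [this, hu, add_zero] at hlt

/-- `ψ` is a well-defined map `Γ \ {0} → Γ` if `K` is a pre-`H`-field. -/
theorem IsPreHField.existsUnique_isPsi {val : AddValuation K (WithTop Γ)}
    (hval : Function.Surjective val) (hK : IsPreHField.{u, v, w} val) {γ : Γ} (hγ : γ ≠ 0) :
    ∃! δ : Γ, IsPsi val γ δ := by
  have hlt : ∀ u a : K, val u = 0 → val a = (γ : WithTop Γ) →
      val (Differential.logDeriv a) < val (Differential.logDeriv u) := by
    intro u a hu ha
    rcases lt_or_gt_of_ne hγ with h | h
    · exact hK.val_logDeriv_lt hu (by rw [ha]; exact_mod_cast h)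
    · have hinv : Differential.logDeriv a⁻¹ = - Differential.logDeriv a := by
        have h1 : a ≠ 0 := by rintro rfl; simp at ha
        have := Differential.logDeriv_div 1 a one_ne_zero h1
        simpa using this
      have h1 : val a⁻¹ = ((-γ : Γ) : WithTop Γ) := by
        have h2 : val a⁻¹ + val a = 0 := by
          rw [← AddValuation.map_mul, inv_mul_cancel₀, AddValuation.map_one]
          rintro rfl; simp at ha
        rw [ha] at h2
        cases h3 : val a⁻¹ with
        | top => rw [h3] at h2; simp at h2
        | coe x =>
          rw [h3] at h2
          have h4 : x + γ = 0 := by exact_mod_cast h2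
          rw [eq_neg_of_add_eq_zero_left h4]
      have := hK.val_logDeriv_lt (b := a⁻¹) hu (by
        rw [h1]; exact_mod_cast neg_lt_zero.2 h)
      rwa [hinv, AddValuation.map_neg] at this
  obtain ⟨a, ha⟩ := hval (γ : WithTop Γ)
  have ha0 : a ≠ 0 := by rintro rfl; simp at ha
  have hfin := ne_top_of_lt (hlt 1 a (AddValuation.map_one _) ha)
  obtain ⟨δ, hδ⟩ := WithTop.ne_top_iff_exists.1 hfin
  refine ⟨δ, ⟨hγ, a, ha, hδ.symm⟩, ?_⟩
  rintro δ' ⟨-, b, hb, hδ'⟩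
  have hb0 : b ≠ 0 := by rintro rfl; simp at hb
  have hu : val (b / a) = 0 := by
    have h2 : val (b / a) + val a = val b := by
      rw [← AddValuation.map_mul, div_mul_cancel₀ _ ha0]
    rw [ha, hb] at h2
    cases h3 : val (b / a) with
    | top => rw [h3] at h2; simp at h2
    | coe x =>
      rw [h3] at h2
      have h4 : x + γ = γ := by exact_mod_cast h2
      rw [add_eq_right.1 h4]; rfl
  have h5 := hlt _ a hu ha
  have h6 : Differential.logDeriv b = Differential.logDeriv a + Differential.logDeriv (b / a) := by
    rw [Differential.logDeriv_div _ _ hb0 ha0]; ring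
  have h7 := AddValuation.map_add_eq_of_lt_right val h5
  rw [add_comm, ← h6, hδ', ← hδ] at h7
  exact_mod_cast h7

/-- The set `Ψ = {ψ(γ) : γ ∈ Γ, γ ≠ 0}`. -/
def Psi (val : AddValuation K (WithTop Γ)) : Set Γ :=
  {δ | ∃ γ : Γ, IsPsi val γ δ}

end Valued

end HFieldIVP

namespace HFieldIVP

section Field

variable {K : Type u} [Field K]

/-! Only affine differential polynomials `p Y + q Y′ + r` are needed. For `∂K = K` one may take `b >
0`: then `Y′ - b` is negative at `0`, and positive at some `y > 0` because derivatives of positive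
elements are arbitrarily large (`IsPreHField.exists_pos_lt_deriv`). Logarithmic derivatives of
positive elements form a group, since `†` turns products into sums. It is convex because, if `a† < s
< b†` with `a, b > 0`, then `Y′ - sY` changes sign between `a` and `b`, and a zero there is a
positive `y` with `y† = s` (`HasIVP.exists_logDeriv_eq`). The claims on `Ψ` follow from these two
facts and the pre-`H`-field inequality `a′ ≺ b†` for `a ≼ 1 ≺ b`
(`IsPreHField.val_logDeriv_lt_val_deriv`). -/

theorem logDeriv_neg [Differential K] (a : K) :
    Differential.logDeriv (-a) = Differential.logDeriv a := by
  simp [Differential.logDeriv]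

theorem logDeriv_inv [Differential K] (a : K) :
    Differential.logDeriv a⁻¹ = -Differential.logDeriv a := by
  rcases eq_or_ne a 0 with rfl | ha
  · simp
  · simpa using Differential.logDeriv_div 1 a one_ne_zero ha

theorem logDeriv_mul_self [Differential K] {a : K} (ha : a ≠ 0) :
    Differential.logDeriv a * a = (a′) :=
  div_mul_cancel₀ _ ha

/-- The intermediate value property for differential polynomials `p Y + q Y′ + r`. -/
theorem HasIVP.exists_linear_eq_zero [LinearOrder K] [Differential K] (h : HasIVP K 1)
    (p q r : K) {f g : K} (hfg : f < g)
    (hf : p * f + q * (f′) + r < 0) (hg : 0 < p * g + q * (g′) + r) :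
    ∃ y, f < y ∧ y < g ∧ p * y + q * (y′) + r = 0 := by
  have heval : ∀ y : K, evalDiffPoly (MvPolynomial.C p * MvPolynomial.X 0 +
      MvPolynomial.C q * MvPolynomial.X 1 + MvPolynomial.C r) y = p * y + q * (y′) + r := by
    intro y
    simp [evalDiffPoly]
  have hmem : MvPolynomial.C p * MvPolynomial.X 0 + MvPolynomial.C q * MvPolynomial.X 1 +
      MvPolynomial.C r ∈ MvPolynomial.supported K {n : ℕ | n ≤ 1} := by
    have hC : ∀ c : K, MvPolynomial.C c ∈ MvPolynomial.supported K {n : ℕ | n ≤ 1} :=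
      fun c => Subalgebra.algebraMap_mem _ c
    have hX : ∀ n : ℕ, n ≤ 1 →
        (MvPolynomial.X n : MvPolynomial ℕ K) ∈ MvPolynomial.supported K {n : ℕ | n ≤ 1} :=
      fun n hn => Algebra.subset_adjoin ⟨n, hn, rfl⟩
    exact add_mem (add_mem (mul_mem (hC p) (hX 0 (by simp))) (mul_mem (hC q) (hX 1 le_rfl))) (hC r)
  simpa only [heval] using h _ hmem f g hfg (by rwa [heval]) (by rwa [heval])

variable {Γ : Type v} [AddCommGroup Γ] [LinearOrder Γ] [IsOrderedAddMonoid Γ]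
  {val : AddValuation K (WithTop Γ)}

theorem val_inv_eq_coe {a : K} {γ : Γ} (ha : val a = γ) : val a⁻¹ = ((-γ : Γ) : WithTop Γ) := by
  have ha0 : a ≠ 0 := by rintro rfl; simp at ha
  have h : val a⁻¹ + val a = 0 := by
    rw [← AddValuation.map_mul, inv_mul_cancel₀ ha0, AddValuation.map_one]
  rw [ha] at h
  cases h' : val a⁻¹ with
  | top => simp [h'] at h
  | coe x =>
    rw [h'] at h
    rw [eq_neg_of_add_eq_zero_left (show x + γ = 0 by exact_mod_cast h)]

theorem mem_Psi_of_val_ne_zero [Differential K] {a : K} {δ : Γ} (ha0 : a ≠ 0) (ha : val a ≠ 0)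
    (hδ : val (Differential.logDeriv a) = δ) : δ ∈ Psi val := by
  obtain ⟨γ, hγ⟩ := WithTop.ne_top_iff_exists.1 (mt (AddValuation.top_iff val).1 ha0)
  refine ⟨γ, ?_, a, hγ.symm, hδ⟩
  rintro rfl
  exact ha hγ.symm

theorem IsPreHField.deriv_pos [LinearOrder K] [Differential K]
    (hK : IsPreHField.{u, v, w} val) {a : K} (ha : 0 < a)
    (hv : val a < 0) : 0 < (a′) := by
  obtain ⟨L, _, _, _, _, ι, hL, hι, hd, hO⟩ := hK
  rw [← hι.lt_iff_lt, map_zero, hd]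
  refine hL.deriv_pos _ ((not_mem_hull_iff_of_pos (by simpa using hι ha)).1 fun h => ?_)
  exact absurd ((hO a).2 h) (not_le.2 hv)

theorem exists_pos_val_eq [LinearOrder K] [IsStrictOrderedRing K]
    (hval : Function.Surjective val) (γ : Γ) :
    ∃ a : K, 0 < a ∧ val a = (γ : WithTop Γ) := by
  obtain ⟨a, ha⟩ := hval γ
  have ha0 : a ≠ 0 := by rintro rfl; simp at ha
  rcases ha0.lt_or_gt with h | h
  · exact ⟨-a, neg_pos.2 h, by rwa [AddValuation.map_neg]⟩
  · exact ⟨a, h, ha⟩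

end Field

/-! ### Logarithmic derivatives of positive elements. -/

section OrderedDifferentialField

variable {K : Type u} [Field K] [LinearOrder K] [IsStrictOrderedRing K] [Differential K]

/-- If `s` lies strictly between the logarithmic derivatives of two positive elements, then it is
itself the logarithmic derivative of a positive element. -/
theorem HasIVP.exists_logDeriv_eq (h : HasIVP K 1) {a b s : K} (ha : 0 < a) (hb : 0 < b)
    (has : Differential.logDeriv a < s) (hsb : s < Differential.logDeriv b) :
    ∃ y, 0 < y ∧ Differential.logDeriv y = s := by
  have ha' : (a′) < s * a := (div_lt_iff₀ ha).1 has
  have hb' : s * b < (b′) := (lt_div_iff₀ hb).1 hsb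
  rcases lt_trichotomy a b with hab | rfl | hab
  · obtain ⟨y, hy, -, h0⟩ := h.exists_linear_eq_zero (-s) 1 0 hab (by linarith) (by linarith)
    have hy0 := ha.trans hy
    exact ⟨y, hy0, (div_eq_iff hy0.ne').2 (by linarith)⟩
  · exact absurd (has.trans hsb) (lt_irrefl _)
  -- Here `b` is the left endpoint, so the polynomial changes sign to `sY - Y′`.
  · obtain ⟨y, hy, -, h0⟩ := h.exists_linear_eq_zero s (-1) 0 hab (by linarith) (by linarith)
    have hy0 := hb.trans hy
    exact ⟨y, hy0, (div_eq_iff hy0.ne').2 (by linarith)⟩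

theorem logDeriv_image_pos_eq_neg :
    Differential.logDeriv '' {a : K | 0 < a} = Differential.logDeriv '' {a : K | a < 0} := by
  ext s
  constructor <;> rintro ⟨a, ha, rfl⟩
  · exact ⟨-a, neg_lt_zero.2 ha, logDeriv_neg a⟩
  · exact ⟨-a, neg_pos.2 ha, logDeriv_neg a⟩

variable (K) in
/-- The group of logarithmic derivatives of positive elements. -/
def logDerivPos : AddSubgroup K where
  carrier := Differential.logDeriv '' {a : K | 0 < a}
  zero_mem' := ⟨1, one_pos, by simp⟩
  add_mem' := by
    rintro _ _ ⟨a, ha : 0 < a, rfl⟩ ⟨b, hb : 0 < b, rfl⟩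
    exact ⟨a * b, mul_pos ha hb, Differential.logDeriv_mul a b ha.ne' hb.ne'⟩
  neg_mem' := by
    rintro _ ⟨a, ha : 0 < a, rfl⟩
    exact ⟨a⁻¹, inv_pos.2 ha, logDeriv_inv a⟩

theorem HasIVP.ordConnected_logDerivPos (h : HasIVP K 1) :
    (logDerivPos K : Set K).OrdConnected := by
  constructor
  rintro _ ⟨a, ha, rfl⟩ _ ⟨b, hb, rfl⟩ s ⟨has, hsb⟩
  rcases has.eq_or_lt with rfl | has
  · exact ⟨a, ha, rfl⟩
  rcases hsb.eq_or_lt with rfl | hsb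
  · exact ⟨b, hb, rfl⟩
  exact h.exists_logDeriv_eq ha hb has hsb

end OrderedDifferentialField

/-! ### Compatibility of order and valuation, surjectivity of the derivation, and the set `Ψ`. -/

section Valued

variable {K : Type u} [Field K] [LinearOrder K] [IsStrictOrderedRing K] [Differential K]
  {Γ : Type v} [AddCommGroup Γ] [LinearOrder Γ] [IsOrderedAddMonoid Γ]
  {val : AddValuation K (WithTop Γ)}

theorem IsPreHField.val_nonneg_of_abs_le_one (hK : IsPreHField.{u, v, w} val) {a : K}
    (ha : |a| ≤ 1) : 0 ≤ val a := by
  obtain ⟨L, _, _, _, _, ι, -, hι, -, hv⟩ := hK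
  obtain ⟨h1, h2⟩ := abs_le.1 ha
  refine (hv a).2 ⟨-1, neg_mem (one_mem _), 1, one_mem _, ?_, ?_⟩
  · simpa using hι.monotone h1
  · simpa using hι.monotone h2

/-- The quotient `a / b` lies in `(0, 1]`, hence in the valuation ring, which contains every element
bounded by `1`. -/
theorem IsPreHField.val_le_of_pos_of_le (hK : IsPreHField.{u, v, w} val) {a b : K}
    (ha : 0 < a) (hab : a ≤ b) : val b ≤ val a := by
  have hb := ha.trans_le hab
  have h : 0 ≤ val (a / b) := hK.val_nonneg_of_abs_le_one (by
    rw [abs_of_pos (div_pos ha hb)]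
    exact (div_le_one hb).2 hab)
  calc val b = 0 + val b := (zero_add _).symm
    _ ≤ val (a / b) + val b := by gcongr
    _ = val a := by rw [← AddValuation.map_mul, div_mul_cancel₀ _ hb.ne']

theorem IsPreHField.logDeriv_pos (hK : IsPreHField.{u, v, w} val) {a : K} (ha : 0 < a)
    (hv : val a < 0) : 0 < Differential.logDeriv a :=
  div_pos (hK.deriv_pos ha hv) ha

/-- In a pre-`H`-field, `a′ ≺ b†` whenever `a ≼ 1` and `b ≻ 1`. -/
theorem IsPreHField.val_logDeriv_lt_val_deriv (hK : IsPreHField.{u, v, w} val) {a b : K}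
    (ha : 0 ≤ val a) (hb : val b < 0) : val (Differential.logDeriv b) < val (a′) := by
  rcases ha.eq_or_lt with ha | ha
  · have ha0 : a ≠ 0 := by rintro rfl; simp at ha
    have := hK.val_logDeriv_lt ha.symm hb
    rwa [← logDeriv_mul_self ha0, AddValuation.map_mul, ← ha, add_zero]
  -- If `a ≺ 1`, pass to the unit `1 + a`, which has the same derivative as `a`.
  · have h1 : val (1 + a) = 0 := by
      rw [AddValuation.map_add_eq_of_lt_left, AddValuation.map_one]
      rwa [AddValuation.map_one]
    have h0 : 1 + a ≠ 0 := by intro h; simp [h] at h1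
    have h2 : (1 + a)′ = a′ := by simp
    have := hK.val_logDeriv_lt h1 hb
    rwa [← h2, ← logDeriv_mul_self h0, AddValuation.map_mul, h1, add_zero]

/-- Every element of `Ψ` is the valuation of `a†` for some `a > 0` with `a ≻ 1`. -/
theorem exists_pos_val_neg_of_mem_Psi {β : Γ} (hβ : β ∈ Psi val) :
    ∃ a : K, 0 < a ∧ val a < 0 ∧ val (Differential.logDeriv a) = β := by
  obtain ⟨γ, hγ, a, ha, hβ⟩ := hβ
  have key : ∃ a : K, val a < 0 ∧ val (Differential.logDeriv a) = β := by
    rcases hγ.lt_or_gt with h | h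
    · exact ⟨a, by rw [ha]; exact_mod_cast h, hβ⟩
    · refine ⟨a⁻¹, ?_, by rwa [logDeriv_inv, AddValuation.map_neg]⟩
      rw [val_inv_eq_coe ha]
      exact_mod_cast neg_lt_zero.2 h
  obtain ⟨a, ha, hβ⟩ := key
  have ha0 : a ≠ 0 := by rintro rfl; simp at ha
  rcases ha0.lt_or_gt with h | h
  · exact ⟨-a, neg_pos.2 h, by rwa [AddValuation.map_neg], by rwa [logDeriv_neg]⟩
  · exact ⟨a, h, ha, hβ⟩

/-- In a pre-`H`-field with nontrivial value group, derivatives of positive elements are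
arbitrarily large. -/
theorem IsPreHField.exists_pos_lt_deriv (hK : IsPreHField.{u, v, w} val)
    (hval : Function.Surjective val) [Nontrivial Γ] {b : K} (hb : 0 < b) :
    ∃ y : K, 0 < y ∧ b < (y′) := by
  obtain ⟨γ, hγ⟩ := exists_lt (0 : Γ)
  obtain ⟨a, ha, hva⟩ := exists_pos_val_eq hval γ
  have hva : val a < 0 := by rw [hva]; exact_mod_cast hγ
  have ha1 : 1 < a := by
    by_contra h
    exact absurd (hK.val_nonneg_of_abs_le_one (by rw [abs_of_pos ha]; exact not_lt.1 h))
      (not_le.2 hva)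
  have hda := hK.logDeriv_pos ha hva
  -- The witness is `y = a · z` with `z = a(1 + c)` and `c = b / a†`. Both factors are positive and
  -- `≻ 1`, so `y† = a† + z† > a†`. Also `y > c` because `a > 1`, whence `y′ = y† y > a† c = b`.
  have hc : 0 < b / Differential.logDeriv a := div_pos hb hda
  set c := b / Differential.logDeriv a with hcdef
  have hz : a ≤ a * (1 + c) := le_mul_of_one_le_right ha.le (by linarith)
  have hz0 := ha.trans_le hz
  have hdz := hK.logDeriv_pos hz0 ((hK.val_le_of_pos_of_le ha hz).trans_lt hva)
  have hy : 0 < a * (a * (1 + c)) := mul_pos ha hz0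
  refine ⟨a * (a * (1 + c)), hy, ?_⟩
  rw [← logDeriv_mul_self hy.ne', Differential.logDeriv_mul _ _ ha.ne' hz0.ne']
  have hcy : c < a * (a * (1 + c)) := by nlinarith
  calc b = Differential.logDeriv a * c := by rw [hcdef, mul_div_cancel₀ _ hda.ne']
    _ < Differential.logDeriv a * (a * (a * (1 + c))) := mul_lt_mul_of_pos_left hcy hda
    _ ≤ _ := mul_le_mul_of_nonneg_right (by linarith) hy.le

theorem IsPreHField.deriv_surjective (hK : IsPreHField.{u, v, w} val)
    (hval : Function.Surjective val) [Nontrivial Γ] (hIVP : HasIVP K 1) (b : K) :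
    ∃ a : K, (a′) = b := by
  have key : ∀ b : K, 0 < b → ∃ a : K, (a′) = b := by
    intro b hb
    obtain ⟨g, hg, hbg⟩ := hK.exists_pos_lt_deriv hval hb
    obtain ⟨y, -, -, hy⟩ := hIVP.exists_linear_eq_zero 0 1 (-b) hg (by simpa) (by linarith)
    exact ⟨y, by linarith⟩
  rcases lt_trichotomy b 0 with hb | rfl | hb
  · obtain ⟨a, ha⟩ := key (-b) (neg_pos.2 hb)
    exact ⟨-a, by rw [map_neg, ha, neg_neg]⟩
  · exact ⟨0, map_zero _⟩
  · exact key b hb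

/-- Write `β = v(b†)` with `b ≻ 1` and integrate: `a′ = b†`. Then `a ≻ 1`, as `a ≼ 1` would force
`a′ ≺ b†`. So `v(a†) = β - v(a) > β`. -/
theorem IsPreHField.not_isGreatest_Psi (hK : IsPreHField.{u, v, w} val)
    (hd : ∀ b : K, ∃ a : K, (a′) = b) (β : Γ) : ¬ IsGreatest (Psi val) β := by
  rintro ⟨hβ, hmax⟩
  obtain ⟨b, -, hb, hβb⟩ := exists_pos_val_neg_of_mem_Psi hβ
  obtain ⟨a, ha⟩ := hd (Differential.logDeriv b)
  have hva : val a < 0 := by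
    by_contra h
    have := hK.val_logDeriv_lt_val_deriv (not_lt.1 h) hb
    rw [ha] at this
    exact lt_irrefl _ this
  have ha0 : a ≠ 0 := by rintro rfl; simp at hva
  have hsum : val (Differential.logDeriv a) + val a = β := by
    rw [← AddValuation.map_mul, logDeriv_mul_self ha0, ha, hβb]
  cases hδ : val (Differential.logDeriv a) with
  | top => simp [hδ] at hsum
  | coe δ =>
    obtain ⟨γ, hγ⟩ := WithTop.ne_top_iff_exists.1 hva.ne_top
    have hδβ := hmax (mem_Psi_of_val_ne_zero ha0 hva.ne hδ)
    rw [hδ, ← hγ] at hsum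
    rw [← hγ] at hva
    have h1 : δ + γ = β := by exact_mod_cast hsum
    have h2 : γ < 0 := by exact_mod_cast hva
    exact absurd (h1 ▸ add_lt_of_neg_right δ h2) (not_lt.2 hδβ)

/-- A positive `s` with `v(s)` strictly between `v(a†)` and `v(b†)` lies strictly between the
positive elements `b†` and `a†`, so it is itself a logarithmic derivative. -/
theorem IsPreHField.ordConnected_Psi (hK : IsPreHField.{u, v, w} val)
    (hval : Function.Surjective val) (hIVP : HasIVP K 1) : (Psi val).OrdConnected := by
  constructor
  intro β₁ h₁ β₂ h₂ γ hγ
  rcases hγ.1.eq_or_lt with rfl | hγ₁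
  · exact h₁
  rcases hγ.2.eq_or_lt with rfl | hγ₂
  · exact h₂
  obtain ⟨a, ha, hva, haβ⟩ := exists_pos_val_neg_of_mem_Psi h₁
  obtain ⟨b, hb, hvb, hbβ⟩ := exists_pos_val_neg_of_mem_Psi h₂
  obtain ⟨s, hs, hsγ⟩ := exists_pos_val_eq hval γ
  have hsa : s < Differential.logDeriv a := by
    by_contra h
    have := hK.val_le_of_pos_of_le (hK.logDeriv_pos ha hva) (not_lt.1 h)
    rw [hsγ, haβ] at this
    exact absurd hγ₁ (not_lt.2 (by exact_mod_cast this))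
  have hbs : Differential.logDeriv b < s := by
    by_contra h
    have := hK.val_le_of_pos_of_le hs (not_lt.1 h)
    rw [hsγ, hbβ] at this
    exact absurd hγ₂ (not_lt.2 (by exact_mod_cast this))
  obtain ⟨y, hy, rfl⟩ := hIVP.exists_logDeriv_eq hb ha hbs hsa
  -- It remains to exclude `y ≍ 1`: in that case `y† ≺ b†`, contradicting `γ < β₂`.
  refine mem_Psi_of_val_ne_zero hy.ne' (fun h0 => ?_) hsγ
  have := hK.val_logDeriv_lt h0 hvb
  rw [hsγ, hbβ] at this
  exact absurd hγ₂ (not_lt.2 (le_of_lt (by exact_mod_cast this)))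

end Valued

end HFieldIVP

theorem lemma1p1 {K : Type u} [Field K] [LinearOrder K] [IsStrictOrderedRing K]
    [Differential K] {Γ : Type v} [AddCommGroup Γ] [LinearOrder Γ] [IsOrderedAddMonoid Γ]
    (val : AddValuation K (WithTop Γ)) (hval : Function.Surjective val)
    (hK : HFieldIVP.IsPreHField.{u, v, w} val)
    (hΓ : Nontrivial Γ) (hIVP : HFieldIVP.HasIVP K 1) :
    (∀ b : K, ∃ a : K, (a′) = b) ∧
    Differential.logDeriv '' {a : K | 0 < a} = Differential.logDeriv '' {a : K | a < 0} ∧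
    (∃ H : AddSubgroup K, (H : Set K) = Differential.logDeriv '' {a : K | 0 < a} ∧
      (H : Set K).OrdConnected) ∧
    (¬ ∃ β : Γ, IsGreatest (HFieldIVP.Psi val) β) ∧
    (HFieldIVP.Psi val).OrdConnected := by
  have hd := hK.deriv_surjective hval hIVP
  exact ⟨hd, HFieldIVP.logDeriv_image_pos_eq_neg,
    ⟨HFieldIVP.logDerivPos K, rfl, hIVP.ordConnected_logDerivPos⟩,
    fun ⟨β, hβ⟩ => hK.not_isGreatest_Psi hd β hβ, hK.ordConnected_Psi hval hIVP⟩
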